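/- Let $\mathbf{k}$ be a commutative ring with identity. Algebras are associative $\mathbf{k}$-algebras, not necessarily with identity. For $\lambda\in\mathbf{k}$ consider triples $(A,d,P)$, where $A$ is an algebra and $d,P:A\to A$ are $\mathbf{k}$-linear maps with $$d(ab)=d(a)b+a\,d(b)+\lambda\,d(a)d(b),\qquad P(a)P(b)=P(aP(b))+P(P(a)b)+\lambda P(ab),\qquad dP=Pd$$ for all $a,b\in A$. Such a triple is a *para-differential Rota-Baxter algebra of type I* if $\lambda=0$, and *of type II* (of weight $\lambda$) if $\lambda\neq0$. Morphisms are (not necessarily unital) algebra homomorphisms commuting with $d$ and with $P$. Let $X$ be a set, and let $\mathfrak{S}(X)$ be the set of bracketed words on $X$, i.e. the free semigroup on $X$ with two unary operators $D$ and $P$: its elements are nonempty words whose letters are elements of $X$ or of the form $D(u)$ or $P(u)$ with $u\in\mathfrak{S}(X)$. Put $\Delta(X)=\{D^n(x)\mid x\in X,\ n\ge0\}$, let $\mathfrak{X}_0$ be the subsemigroup generated by $\Delta(X)$, and for $n\ge1$ let $\mathfrak{X}_n=\Lambda(\mathfrak{X}_0,\mathfrak{X}_{n-1})$, where $$\Lambda(Y,Z)=\bigcup_{r\ge1}(YP(Z))^r\cup\bigcup_{r\ge0}(YP(Z))^rY\cup\bigcup_{r\ge1}(P(Z)Y)^r\cup\bigcup_{r\ge0}(P(Z)Y)^rP(Z).$$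 Let $\mathfrak{X}_\infty=\bigcup_{n\ge0}\mathfrak{X}_n$ (the differential Rota-Baxter bracketed words) and let $\mathbf{k}\mathfrak{X}_\infty$ be the free $\mathbf{k}$-module on $\mathfrak{X}_\infty$. Every $u\in\mathfrak{X}_\infty$ has a unique standard decomposition $u=u_1\cdots u_m$ with factors alternately in $\mathfrak{X}_0$ and in $P(\mathfrak{X}_\infty)$. For $\lambda\in\mathbf{k}$ define on $\mathbf{k}\mathfrak{X}_\infty$, by (bi)linear extension from $\mathfrak X_\infty$: - the product $\diamond$: for $u,v\in\mathfrak{X}_\infty$ with standard decompositions $u=u_1\cdots u_m$, $v=v_1\cdots v_n$, put $u\diamond v=u_1\cdots u_{m-1}(u_m\diamond v_1)v_2\cdots v_n$, where $u_m\diamond v_1=P(\bar u\diamond P(\bar v))+P(P(\bar u)\diamond\bar v)+\lambda P(\bar u\diamond\bar v)$ if $u_m=P(\bar u)$ and $v_1=P(\bar v)$, and $u_m\diamond v_1=u_mv_1$ (concatenation) otherwise; - the operator $d_X$: $d_X(u)=D(u)$ for $u\in\Delta(X)$; $d_X(P(u))=P(d_X(u))$ for $u\in\mathfrak X_\infty$;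 and $d_X(u_1w)=d_X(u_1)w+u_1d_X(w)+\lambda\,d_X(u_1)d_X(w)$ (products are concatenations) for a word $u_1w\in\mathfrak{X}_\infty$ with first letter $u_1\in\Delta(X)\cup P(\mathfrak{X}_\infty)$ and nonempty remainder $w$; - the operator $P_X(u)=P(u)$. These operations are well defined on $\mathbf{k}\mathfrak{X}_\infty$. Let $j_X:X\to\mathbf{k}\mathfrak{X}_\infty$ be the map $x\mapsto x$. **Theorem.** For $\lambda=0$, $(\mathbf{k}\mathfrak{X}_\infty,\diamond,d_X,P_X)$ with $j_X$ is the free para-differential Rota-Baxter algebra of type I on $X$. For every $\lambda\in\mathbf{k}$ with $\lambda\ne0$, $(\mathbf{k}\mathfrak{X}_\infty,\diamond,d_X,P_X)$ with $j_X$ is the free para-differential Rota-Baxter algebra of type II of weight $\lambda$ on $X$. That is: it is a para-differential Rota-Baxter algebra of that type (and weight), and for every para-differential Rota-Baxter algebra $(A,d,P)$ of the same type (and weight) and every map $f:X\to A$ there is exactly one morphism $\varphi:\mathbf{k}\mathfrak{X}_\infty\to A$ with $\varphi\circ j_X=f$. -/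

import Mathlib

open scoped Pointwise

universe u v w x

/-! ### Para-differential Rota-Baxter algebras -/

section Algebras

/-- `(A, d, P)` is an associative (not necessarily unital) `k`-algebra with a differential operator
`d` of weight `lam` and a Rota-Baxter operator `P` of weight `lam` satisfying `d P = P d`. -/
structure IsParaDiffRotaBaxter {k : Type u} [CommRing k] (lam : k) {A : Type v}
    [NonUnitalNonAssocRing A] [Module k A] (d P : A →ₗ[k] A) : Prop where
  mul_assoc : ∀ a b c : A, (a * b) * c = a * (b * c)
  d_mul : ∀ a b : A, d (a * b) = d a * b + a * d b + lam • (d a * d b)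
  P_mul_P : ∀ a b : A, P a * P b = P (a * P b) + P (P a * b) + lam • P (a * b)
  d_P : ∀ a : A, d (P a) = P (d a)

/-- Type I: the weight is zero and `d P = P d`. -/
def IsTypeI {k : Type u} [CommRing k] {A : Type v}
    [NonUnitalNonAssocRing A] [Module k A] (d P : A →ₗ[k] A) : Prop :=
  IsParaDiffRotaBaxter (0 : k) d P

/-- Type II: the weight `lam` is nonzero and `d P = P d`. -/
def IsTypeII {k : Type u} [CommRing k] (lam : k) {A : Type v}
    [NonUnitalNonAssocRing A] [Module k A] (d P : A →ₗ[k] A) : Prop :=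
  lam ≠ 0 ∧ IsParaDiffRotaBaxter lam d P

/-- `(F, d, P)` with `j : X → F` is the free para-differential Rota-Baxter algebra of type I
on `X`. -/
def IsFreeTypeI (k : Type u) [CommRing k] {X : Type x} {F : Type v}
    [NonUnitalNonAssocRing F] [Module k F] [IsScalarTower k F F] [SMulCommClass k F F]
    (d P : F →ₗ[k] F) (j : X → F) : Prop :=
  IsTypeI d P ∧
    ∀ (A : Type w) [NonUnitalNonAssocRing A] [Module k A] [IsScalarTower k A A]
      [SMulCommClass k A A] (dA PA : A →ₗ[k] A), IsTypeI dA PA → ∀ f : X → A,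
        ∃! φ : F →ₙₐ[k] A,
          (∀ a, φ (d a) = dA (φ a)) ∧ (∀ a, φ (P a) = PA (φ a)) ∧ ∀ x, φ (j x) = f x

/-- `(F, d, P)` with `j : X → F` is the free para-differential Rota-Baxter algebra of type II
and weight `lam` on `X`. -/
def IsFreeTypeII {k : Type u} [CommRing k] (lam : k) {X : Type x} {F : Type v}
    [NonUnitalNonAssocRing F] [Module k F] [IsScalarTower k F F] [SMulCommClass k F F]
    (d P : F →ₗ[k] F) (j : X → F) : Prop :=
  IsTypeII lam d P ∧
    ∀ (A : Type w) [NonUnitalNonAssocRing A] [Module k A] [IsScalarTower k A A]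
      [SMulCommClass k A A] (dA PA : A →ₗ[k] A), IsTypeII lam dA PA → ∀ f : X → A,
        ∃! φ : F →ₙₐ[k] A,
          (∀ a, φ (d a) = dA (φ a)) ∧ (∀ a, φ (P a) = PA (φ a)) ∧ ∀ x, φ (j x) = f x

end Algebras

/-! ### Bracketed words: the free semigroup with two operators -/

/-- The two operator symbols. -/
inductive OpSym : Type
  | D
  | P

/-- Bracketed words on `X`: nonempty words whose letters are elements of `X` or brackets
`⌊u⌋_D`, `⌊u⌋_P` of bracketed words `u`. A word is either a single letter (`var x`, `br o u`), or a
letter followed by a word (`varMul x w`, `brMul o u w`). -/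
inductive OpWord (X : Type v) : Type v
  | var (x : X)
  | br (o : OpSym) (u : OpWord X)
  | varMul (x : X) (w : OpWord X)
  | brMul (o : OpSym) (u : OpWord X) (w : OpWord X)

namespace OpWord

variable {X : Type v}

/-- Concatenation of bracketed words. -/
def append : OpWord X → OpWord X → OpWord X
  | var x, v => varMul x v
  | br o u, v => brMul o u v
  | varMul x w, v => varMul x (append w v)
  | brMul o u w, v => brMul o u (append w v)

theorem append_assoc (a b c : OpWord X) :
    append (append a b) c = append a (append b c) := by
  induction a with
  | var x => rfl
  | br o u _ => rfl
  | varMul x w ih => simp [append, ih]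
  | brMul o u w _ ih => simp [append, ih]

instance : Semigroup (OpWord X) where
  mul := append
  mul_assoc := append_assoc

@[simp] theorem var_mul (x : X) (v : OpWord X) : var x * v = varMul x v := rfl
@[simp] theorem br_mul (o : OpSym) (u v : OpWord X) : br o u * v = brMul o u v := rfl
@[simp] theorem varMul_mul (x : X) (w v : OpWord X) : varMul x w * v = varMul x (w * v) := rfl
@[simp] theorem brMul_mul (o : OpSym) (u w v : OpWord X) :
    brMul o u w * v = brMul o u (w * v) := rfl

/-! ### Differential Rota-Baxter bracketed words -/

/-- `Δ(X) = {Dⁿ(x) | x ∈ X, n ≥ 0}`. -/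
def Delta (X : Type v) : Set (OpWord X) :=
  {w | ∃ (x : X) (n : ℕ), w = (br OpSym.D)^[n] (var x)}

/-- The alternating product
`Λ(Y,Z) = ⋃_{r≥1} (Y P(Z))^r ∪ ⋃_{r≥0} (Y P(Z))^r Y ∪ ⋃_{r≥1} (P(Z) Y)^r ∪ ⋃_{r≥0} (P(Z) Y)^r P(Z)`.
The union of the powers `S^r`, `r ≥ 1`, is the subsemigroup generated by `S`. -/
def Alt (Y Z : Set (OpWord X)) : Set (OpWord X) :=
  (Subsemigroup.closure (Y * br OpSym.P '' Z) : Set (OpWord X)) ∪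
  (Y ∪ (Subsemigroup.closure (Y * br OpSym.P '' Z) : Set (OpWord X)) * Y) ∪
  (Subsemigroup.closure (br OpSym.P '' Z * Y) : Set (OpWord X)) ∪
  (br OpSym.P '' Z ∪ (Subsemigroup.closure (br OpSym.P '' Z * Y) : Set (OpWord X)) * br OpSym.P '' Z)

/-- `𝔛₀ = S(Δ(X))`, the subsemigroup generated by `Δ(X)`, and `𝔛ₙ = Λ(𝔛₀, 𝔛ₙ₋₁)`. -/
def drbwLevel (X : Type v) : ℕ → Set (OpWord X)
  | 0 => (Subsemigroup.closure (Delta X) : Set (OpWord X))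
  | n + 1 => Alt (Subsemigroup.closure (Delta X) : Set (OpWord X)) (drbwLevel X n)

/-- `𝔛_∞`, the set of differential Rota-Baxter bracketed words. -/
def drbw (X : Type v) : Set (OpWord X) := ⋃ n, drbwLevel X n

/-! A letterwise description of the set `𝔛_∞`, needed to see that it is closed under the
operations defined below. -/

/-- The word starts with a letter `P(u)`. -/
def StartsP : OpWord X → Prop
  | br OpSym.P _ => True
  | brMul OpSym.P _ _ => True
  | _ => False

/-- The word ends with a letter `P(u)`. -/
def EndsP : OpWord X → Prop
  | var _ => False
  | br OpSym.P _ => True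
  | br OpSym.D _ => False
  | varMul _ w => EndsP w
  | brMul _ _ w => EndsP w

/-- `D`-brackets occur only in letters `Dⁿ(x)`, and no two letters `P(u)` are adjacent. -/
def Good : OpWord X → Prop
  | var _ => True
  | br OpSym.D u => u ∈ Delta X
  | br OpSym.P u => Good u
  | varMul _ w => Good w
  | brMul OpSym.D u w => u ∈ Delta X ∧ Good w
  | brMul OpSym.P u w => Good u ∧ Good w ∧ ¬ StartsP w

theorem good_brP {u : OpWord X} (h : Good u) : Good (br OpSym.P u) := h

theorem delta_cases {w : OpWord X} (h : w ∈ Delta X) :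
    (∃ x, w = var x) ∨ ∃ u ∈ Delta X, w = br OpSym.D u := by
  obtain ⟨x, n, rfl⟩ := h
  cases n with
  | zero => exact Or.inl ⟨x, rfl⟩
  | succ n => exact Or.inr ⟨_, ⟨x, n, rfl⟩, Function.iterate_succ_apply' _ _ _⟩

theorem var_mem_delta (x : X) : var x ∈ Delta X := ⟨x, 0, rfl⟩

theorem brD_mem_delta {u : OpWord X} (h : u ∈ Delta X) : br OpSym.D u ∈ Delta X := by
  obtain ⟨x, n, rfl⟩ := h
  exact ⟨x, n + 1, (Function.iterate_succ_apply' _ _ _).symm⟩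

theorem startsP_mul (u v : OpWord X) : StartsP (u * v) ↔ StartsP u := by
  cases u with
  | var x => exact Iff.rfl
  | br o a => cases o <;> exact Iff.rfl
  | varMul x w => exact Iff.rfl
  | brMul o a w => cases o <;> exact Iff.rfl

theorem endsP_mul (u v : OpWord X) : EndsP (u * v) ↔ EndsP v := by
  induction u with
  | var x => exact Iff.rfl
  | br o a _ => exact Iff.rfl
  | varMul x w ih => exact ih
  | brMul o a w _ ih => exact ih

theorem good_mul {u v : OpWord X} (hu : Good u) (hv : Good v) (h : EndsP u → ¬ StartsP v) :
    Good (u * v) := by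
  induction u with
  | var x => exact hv
  | br o a _ =>
    cases o
    · exact ⟨hu, hv⟩
    · exact ⟨hu, hv, h trivial⟩
  | varMul x w ih => exact ih hu h
  | brMul o a w _ ih =>
    cases o
    · exact ⟨hu.1, ih hu.2 h⟩
    · exact ⟨hu.1, ih hu.2.1 h, fun hs => hu.2.2 ((startsP_mul w v).1 hs)⟩

theorem good_closure_delta {w : OpWord X} (h : w ∈ Subsemigroup.closure (Delta X)) :
    Good w ∧ ¬ StartsP w ∧ ¬ EndsP w := by
  induction h using Subsemigroup.closure_induction with
  | mem w hw =>
    rcases delta_cases hw with ⟨x, rfl⟩ | ⟨u, hu, rfl⟩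
    · exact ⟨trivial, id, id⟩
    · exact ⟨hu, id, id⟩
  | mul u v _ _ hu hv =>
    exact ⟨good_mul hu.1 hv.1 fun _ => hv.2.1, by rw [startsP_mul]; exact hu.2.1,
      by rw [endsP_mul]; exact hv.2.2⟩

theorem good_of_mem_level (n : ℕ) {w : OpWord X} (h : w ∈ drbwLevel X n) : Good w := by
  induction n generalizing w with
  | zero => exact (good_closure_delta h).1
  | succ n ih =>
    have hA : ∀ a ∈ Subsemigroup.closure
        ((Subsemigroup.closure (Delta X) : Set (OpWord X)) * br OpSym.P '' drbwLevel X n),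
        Good a ∧ ¬ StartsP a := by
      intro a ha
      induction ha using Subsemigroup.closure_induction with
      | mem a ha =>
        obtain ⟨y, hy, _, ⟨z, hz, rfl⟩, rfl⟩ := ha
        have h1 := good_closure_delta hy
        exact ⟨good_mul h1.1 (good_brP (ih hz)) fun h => absurd h h1.2.2, by
          rw [startsP_mul]; exact h1.2.1⟩
      | mul u v _ _ hu hv =>
        exact ⟨good_mul hu.1 hv.1 fun _ => hv.2, by rw [startsP_mul]; exact hu.2⟩
    have hB : ∀ a ∈ Subsemigroup.closure
        (br OpSym.P '' drbwLevel X n * (Subsemigroup.closure (Delta X) : Set (OpWord X))),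
        Good a ∧ ¬ EndsP a := by
      intro a ha
      induction ha using Subsemigroup.closure_induction with
      | mem a ha =>
        obtain ⟨_, ⟨z, hz, rfl⟩, y, hy, rfl⟩ := ha
        have h1 := good_closure_delta hy
        exact ⟨good_mul (good_brP (ih hz)) h1.1 fun _ => h1.2.1, by rw [endsP_mul]; exact h1.2.2⟩
      | mul u v _ _ hu hv =>
        exact ⟨good_mul hu.1 hv.1 fun h => absurd h hu.2, by rw [endsP_mul]; exact hv.2⟩
    rcases h with ((h | h | h) | h) | h | h
    · exact (hA _ h).1
    · exact (good_closure_delta h).1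
    · obtain ⟨a, ha, y, hy, rfl⟩ := h
      have h1 := good_closure_delta hy
      exact good_mul (hA _ ha).1 h1.1 fun _ => h1.2.1
    · exact (hB _ h).1
    · obtain ⟨z, hz, rfl⟩ := h
      exact good_brP (ih hz)
    · obtain ⟨b, hb, _, ⟨z, hz, rfl⟩, rfl⟩ := h
      exact good_mul (hB _ hb).1 (good_brP (ih hz)) fun h => absurd h (hB _ hb).2

theorem alt_mono {Y Z Z' : Set (OpWord X)} (h : Z ⊆ Z') : Alt Y Z ⊆ Alt Y Z' := by
  have hP : br OpSym.P '' Z ⊆ br OpSym.P '' Z' := Set.image_mono h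
  have hA := Subsemigroup.closure_mono (Set.mul_subset_mul_left (s := Y) hP)
  have hB := Subsemigroup.closure_mono (Set.mul_subset_mul_right (t := Y) hP)
  unfold Alt
  gcongr

theorem level_mono_succ (n : ℕ) : drbwLevel X n ⊆ drbwLevel X (n + 1) := by
  induction n with
  | zero => exact fun w hw => Or.inl (Or.inl (Or.inr (Or.inl hw)))
  | succ n ih => exact alt_mono ih

theorem level_mono : Monotone (drbwLevel X) := monotone_nat_of_le_succ level_mono_succ

/-- Shifting an alternating word by one letter. -/
theorem shift_mem (S T : Set (OpWord X)) {s b : OpWord X} (hs : s ∈ S)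
    (hb : b ∈ Subsemigroup.closure (T * S)) :
    s * b ∈ (Subsemigroup.closure (S * T) : Set (OpWord X)) * S := by
  induction hb using Subsemigroup.closure_induction generalizing s with
  | mem b hb =>
    obtain ⟨t, ht, s', hs', rfl⟩ := hb
    exact ⟨s * t, Subsemigroup.subset_closure ⟨s, hs, t, ht, rfl⟩, s', hs', mul_assoc _ _ _⟩
  | mul u v _ _ hu hv =>
    obtain ⟨a, ha, s1, hs1, e1⟩ := hu hs
    obtain ⟨a2, ha2, s2, hs2, e2⟩ := hv hs1
    refine ⟨a * a2, mul_mem ha ha2, s2, hs2, ?_⟩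
    simp only at e1 e2 ⊢
    rw [mul_assoc, e2, ← mul_assoc, e1, mul_assoc]

theorem delta_mul_mem (n : ℕ) {y w : OpWord X} (hy : y ∈ Delta X) (hw : w ∈ drbwLevel X n) :
    y * w ∈ drbwLevel X n := by
  have hy' := Subsemigroup.subset_closure (M := OpWord X) hy
  cases n with
  | zero => exact mul_mem hy' hw
  | succ n =>
    have hA : ∀ a ∈ Subsemigroup.closure
        ((Subsemigroup.closure (Delta X) : Set (OpWord X)) * br OpSym.P '' drbwLevel X n),
        y * a ∈ Subsemigroup.closure
        ((Subsemigroup.closure (Delta X) : Set (OpWord X)) * br OpSym.P '' drbwLevel X n) := by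
      intro a ha
      induction ha using Subsemigroup.closure_induction with
      | mem a ha =>
        obtain ⟨y', hy1, p, hp, rfl⟩ := ha
        exact Subsemigroup.subset_closure ⟨y * y', mul_mem hy' hy1, p, hp, mul_assoc _ _ _⟩
      | mul u v _ hv hu _ =>
        rw [← mul_assoc]
        exact mul_mem hu hv
    rcases hw with ((h | h | h) | h) | h | h
    · exact Or.inl (Or.inl (Or.inl (hA _ h)))
    · exact Or.inl (Or.inl (Or.inr (Or.inl (mul_mem hy' h))))
    · obtain ⟨a, ha, y1, hy1, rfl⟩ := h
      exact Or.inl (Or.inl (Or.inr (Or.inr ⟨y * a, hA _ ha, y1, hy1, mul_assoc _ _ _⟩)))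
    · exact Or.inl (Or.inl (Or.inr (Or.inr (shift_mem _ _ hy' h))))
    · exact Or.inl (Or.inl (Or.inl (Subsemigroup.subset_closure ⟨y, hy', w, h, rfl⟩)))
    · obtain ⟨b, hb, p, hp, rfl⟩ := h
      obtain ⟨a, ha, y1, hy1, e⟩ := shift_mem _ _ hy' hb
      refine Or.inl (Or.inl (Or.inl ?_))
      simp only at e ⊢
      rw [← mul_assoc, ← e, mul_assoc]
      exact mul_mem ha (Subsemigroup.subset_closure ⟨y1, hy1, p, hp, rfl⟩)

theorem brP_mul_mem (n : ℕ) {z w : OpWord X} (hz : z ∈ drbwLevel X n)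
    (hw : w ∈ drbwLevel X (n + 1)) (hs : ¬ StartsP w) :
    br OpSym.P z * w ∈ drbwLevel X (n + 1) := by
  have hp : br OpSym.P z ∈ br OpSym.P '' drbwLevel X n := ⟨z, hz, rfl⟩
  rcases hw with ((h | h | h) | h) | h | h
  · exact Or.inr (Or.inr (shift_mem _ _ hp h))
  · exact Or.inl (Or.inr (Subsemigroup.subset_closure ⟨_, hp, w, h, rfl⟩))
  · obtain ⟨a, ha, y, hy, rfl⟩ := h
    obtain ⟨b, hb, p, hp', e⟩ := shift_mem _ _ hp ha
    refine Or.inl (Or.inr ?_)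
    simp only at e ⊢
    rw [← mul_assoc, ← e, mul_assoc]
    exact mul_mem hb (Subsemigroup.subset_closure ⟨p, hp', y, hy, rfl⟩)
  · exfalso
    apply hs
    clear hs
    induction h using Subsemigroup.closure_induction with
    | mem a ha =>
      obtain ⟨_, ⟨z, hz, rfl⟩, y, hy, rfl⟩ := ha
      trivial
    | mul u v _ _ hu _ => exact (startsP_mul u v).2 hu
  · obtain ⟨z, _, rfl⟩ := h
    exact absurd trivial hs
  · exfalso
    obtain ⟨b, hb, p, _, rfl⟩ := h
    apply hs
    clear hs
    refine (startsP_mul b p).2 ?_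
    induction hb using Subsemigroup.closure_induction with
    | mem a ha =>
      obtain ⟨_, ⟨z, hz, rfl⟩, y, hy, rfl⟩ := ha
      trivial
    | mul u v _ _ hu _ => exact (startsP_mul u v).2 hu

theorem mem_level_of_good {w : OpWord X} (h : Good w) : ∃ n, w ∈ drbwLevel X n := by
  induction w with
  | var x => exact ⟨0, Subsemigroup.subset_closure (var_mem_delta x)⟩
  | br o u ih =>
    cases o
    · exact ⟨0, Subsemigroup.subset_closure (brD_mem_delta h)⟩
    · obtain ⟨n, hn⟩ := ih h
      exact ⟨n + 1, Or.inr (Or.inl ⟨u, hn, rfl⟩)⟩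
  | varMul x w ih =>
    obtain ⟨n, hn⟩ := ih h
    exact ⟨n, delta_mul_mem n (var_mem_delta x) hn⟩
  | brMul o u w ihu ihw =>
    cases o
    · obtain ⟨n, hn⟩ := ihw h.2
      exact ⟨n, delta_mul_mem n (brD_mem_delta h.1) hn⟩
    · obtain ⟨n, hn⟩ := ihu h.1
      obtain ⟨m, hm⟩ := ihw h.2.1
      exact ⟨max n m + 1, brP_mul_mem _ (level_mono (le_max_left n m) hn)
        (level_mono ((le_max_right n m).trans (Nat.le_succ _)) hm) h.2.2⟩

theorem mem_drbw_iff {w : OpWord X} : w ∈ drbw X ↔ Good w := by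
  constructor
  · intro h
    obtain ⟨n, hn⟩ := Set.mem_iUnion.1 h
    exact good_of_mem_level n hn
  · intro h
    exact Set.mem_iUnion.2 (mem_level_of_good h)


/-! ### Bracketed polynomials -/

section Polynomials

variable {k : Type u} [CommRing k]

/-- A bracketed word as an element of `k𝔖(X)`, the algebra of bracketed polynomials (the semigroup
algebra of bracketed words, with product extending the concatenation). -/
noncomputable def mono (k : Type u) [CommRing k] {X : Type v} (w : OpWord X) :
    MonoidAlgebra k (OpWord X) :=
  MonoidAlgebra.single w 1

/-- The linear extension to `k𝔖(X)` of a map given on bracketed words. -/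
noncomputable def linExt {M : Type*} [AddCommGroup M] [Module k M] (f : OpWord X → M) :
    MonoidAlgebra k (OpWord X) →ₗ[k] M :=
  Finsupp.linearCombination k f ∘ₗ (MonoidAlgebra.coeffLinearEquiv k).toLinearMap

@[simp] theorem linExt_mono {M : Type*} [AddCommGroup M] [Module k M] (f : OpWord X → M)
    (w : OpWord X) : linExt f (mono k w) = f w := by
  simp [linExt, mono]

theorem mono_mul (u v : OpWord X) : mono k u * mono k v = mono k (u * v) := by
  simp [mono, MonoidAlgebra.single_mul_single]

/-- The linear operator `P` on bracketed polynomials extending `u ↦ P(u)`. -/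
noncomputable def polyP : MonoidAlgebra k (OpWord X) →ₗ[k] MonoidAlgebra k (OpWord X) :=
  linExt fun u => mono k (br OpSym.P u)

/-! ### The product `⋄` and the operator `d` on words -/

/-- The product `u ⋄ v`. Only the last letter `a` of `u` and the first letter `b` of `v` interact:
`(u' a) ⋄ (b v') = u' (a ⋄ b) v'`, where `a ⋄ b` is the concatenation unless `a = P(ā)` and
`b = P(b̄)`, in which case `a ⋄ b = P(ā ⋄ P(b̄)) + P(P(ā) ⋄ b̄) + lam P(ā ⋄ b̄)`. -/
noncomputable def diamond (lam : k) : OpWord X → OpWord X → MonoidAlgebra k (OpWord X)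
  | varMul x u, v => mono k (var x) * diamond lam u v
  | brMul o a u, v => mono k (br o a) * diamond lam u v
  | br OpSym.P a, br OpSym.P b =>
      polyP (diamond lam a (br OpSym.P b)) + polyP (diamond lam (br OpSym.P a) b) +
        lam • polyP (diamond lam a b)
  | br OpSym.P a, brMul OpSym.P b v =>
      (polyP (diamond lam a (br OpSym.P b)) + polyP (diamond lam (br OpSym.P a) b) +
        lam • polyP (diamond lam a b)) * mono k v
  | u, v => mono k (u * v)
termination_by u v => sizeOf u + sizeOf v

/-- The operator `d`, by recursion on words: `d(a) = D(a)` for `a ∈ Δ(X)`, `d(P(u)) = P(d(u))`, and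
`d(a w) = d(a) w + a d(w) + lam d(a) d(w)` for a letter `a` and a word `w`. -/
noncomputable def dWord (lam : k) : OpWord X → MonoidAlgebra k (OpWord X)
  | var x => mono k (br OpSym.D (var x))
  | br OpSym.D u => mono k (br OpSym.D (br OpSym.D u))
  | br OpSym.P u => polyP (dWord lam u)
  | varMul x w =>
      mono k (br OpSym.D (var x)) * mono k w + mono k (var x) * dWord lam w +
        lam • (mono k (br OpSym.D (var x)) * dWord lam w)
  | brMul OpSym.D u w =>
      mono k (br OpSym.D (br OpSym.D u)) * mono k w + mono k (br OpSym.D u) * dWord lam w +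
        lam • (mono k (br OpSym.D (br OpSym.D u)) * dWord lam w)
  | brMul OpSym.P u w =>
      polyP (dWord lam u) * mono k w + mono k (br OpSym.P u) * dWord lam w +
        lam • (polyP (dWord lam u) * dWord lam w)

/-- Bilinear extension of `⋄`. -/
noncomputable def polyDiamond (lam : k) :
    MonoidAlgebra k (OpWord X) →ₗ[k] MonoidAlgebra k (OpWord X) →ₗ[k]
      MonoidAlgebra k (OpWord X) :=
  linExt fun u => linExt fun v => diamond lam u v

/-- Linear extension of `d`. -/
noncomputable def polyD (lam : k) :
    MonoidAlgebra k (OpWord X) →ₗ[k] MonoidAlgebra k (OpWord X) :=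
  linExt fun u => dWord lam u

/-! The recursions in the form of decompositions into arbitrary subwords. -/

theorem diamond_mul_left (lam : k) (u u' v : OpWord X) :
    diamond lam (u * u') v = mono k u * diamond lam u' v := by
  induction u with
  | var x => simp [diamond]
  | br o a _ => simp [diamond]
  | varMul x w ih => simp [diamond, ih, ← mul_assoc, mono_mul]
  | brMul o a w _ ih => simp [diamond, ih, ← mul_assoc, mono_mul]

theorem diamond_mul_right (lam : k) (u v v' : OpWord X) :
    diamond lam u (v * v') = diamond lam u v * mono k v' := by
  induction u with
  | var x => simp [diamond, mono_mul]
  | br o a _ =>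
    cases o
    · simp [diamond, mono_mul]
    · cases v with
      | var x => simp [diamond, mono_mul]
      | br o b => cases o <;> simp [diamond, mono_mul]
      | varMul x w => simp [diamond, mono_mul]
      | brMul o b w => cases o <;> simp [diamond, mono_mul, mul_assoc]
  | varMul x w ih => simp [diamond, ih, mul_assoc]
  | brMul o a w _ ih => simp [diamond, ih, mul_assoc]

theorem diamond_P_P (lam : k) (a b : OpWord X) :
    diamond lam (br OpSym.P a) (br OpSym.P b) =
      polyP (diamond lam a (br OpSym.P b)) + polyP (diamond lam (br OpSym.P a) b) +
        lam • polyP (diamond lam a b) := by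
  rw [diamond]

theorem diamond_concat (lam : k) (u v : OpWord X) (h : ¬ (EndsP u ∧ StartsP v)) :
    diamond lam u v = mono k (u * v) := by
  induction u with
  | var x => simp [diamond]
  | br o a _ =>
    cases o
    · simp [diamond]
    · cases v with
      | var x => simp [diamond]
      | br o b => cases o <;> simp [diamond, EndsP, StartsP] at h ⊢
      | varMul x w => simp [diamond]
      | brMul o b w => cases o <;> simp [diamond, EndsP, StartsP] at h ⊢
  | varMul x w ih => simp [diamond, ih h, mono_mul]
  | brMul o a w _ ih => simp [diamond, ih h, mono_mul]

theorem dWord_mul (lam : k) (u v : OpWord X) :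
    dWord lam (u * v) =
      dWord lam u * mono k v + mono k u * dWord lam v + lam • (dWord lam u * dWord lam v) := by
  induction u with
  | var x => simp [dWord]
  | br o a _ => cases o <;> simp [dWord]
  | varMul x w ih =>
    have e : mono k (varMul x w) = mono k (var x) * mono k w := by rw [mono_mul, var_mul]
    simp only [varMul_mul, dWord, ih, ← mono_mul w v, e, mul_add, add_mul, smul_add,
      mul_smul_comm, smul_mul_assoc, mul_assoc]
    abel
  | brMul o a w _ ih =>
    have e : mono k (brMul o a w) = mono k (br o a) * mono k w := by rw [mono_mul, br_mul]
    cases o <;>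
    simp only [brMul_mul, dWord, ih, ← mono_mul w v, e, mul_add, add_mul, smul_add,
      mul_smul_comm, smul_mul_assoc, mul_assoc] <;>
    abel

/-! ### Closure of `k𝔛_∞` -/

/-- The free module `k𝔛_∞` on the set of differential Rota-Baxter bracketed words, as a submodule
of the bracketed polynomials. -/
noncomputable def drbwSpan (k : Type u) [CommRing k] (X : Type v) :
    Submodule k (MonoidAlgebra k (OpWord X)) :=
  Submodule.span k (mono k '' drbw X)

/-- Span of the words in `𝔛_∞` that may start (end) with a letter `P(u)` only if `s` (`e`) holds. -/
noncomputable def goodSpan (k : Type u) [CommRing k] (X : Type v) (s e : Prop) :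
    Submodule k (MonoidAlgebra k (OpWord X)) :=
  Submodule.span k (mono k '' {w | Good w ∧ (StartsP w → s) ∧ (EndsP w → e)})

theorem drbwSpan_eq : drbwSpan k X = goodSpan k X True True := by
  unfold drbwSpan goodSpan
  congr 2
  ext w
  simp [mem_drbw_iff]

theorem goodSpan_le (s e : Prop) : goodSpan k X s e ≤ drbwSpan k X := by
  rw [drbwSpan_eq]
  exact Submodule.span_mono (Set.image_mono fun w hw => ⟨hw.1, fun _ => trivial, fun _ => trivial⟩)

theorem mono_mem {w : OpWord X} {s e : Prop} (h : Good w) (hs : StartsP w → s)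
    (he : EndsP w → e) : mono k w ∈ goodSpan k X s e :=
  Submodule.subset_span ⟨w, ⟨h, hs, he⟩, rfl⟩

theorem mul_mem_goodSpan {s e s' e' : Prop} {f g : MonoidAlgebra k (OpWord X)}
    (hf : f ∈ goodSpan k X s e) (hg : g ∈ goodSpan k X s' e') (h : e → s' → False) :
    f * g ∈ goodSpan k X s e' := by
  induction hf using Submodule.span_induction with
  | zero => rw [zero_mul]; exact zero_mem _
  | add a b _ _ ha hb => rw [add_mul]; exact add_mem ha hb
  | smul c a _ ha => rw [smul_mul_assoc]; exact Submodule.smul_mem _ _ ha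
  | mem a ha =>
    obtain ⟨u, hu, rfl⟩ := ha
    induction hg using Submodule.span_induction with
    | zero => rw [mul_zero]; exact zero_mem _
    | add a b _ _ ha hb => rw [mul_add]; exact add_mem ha hb
    | smul c a _ ha => rw [mul_smul_comm]; exact Submodule.smul_mem _ _ ha
    | mem b hb =>
      obtain ⟨v, hv, rfl⟩ := hb
      rw [mono_mul]
      exact mono_mem (good_mul hu.1 hv.1 fun h1 h2 => h (hu.2.2 h1) (hv.2.1 h2))
        (fun h1 => hu.2.1 ((startsP_mul u v).1 h1)) (fun h1 => hv.2.2 ((endsP_mul u v).1 h1))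

theorem polyP_mem {f : MonoidAlgebra k (OpWord X)} (hf : f ∈ drbwSpan k X) (s e : Prop)
    (hs : s) (he : e) : polyP f ∈ goodSpan k X s e := by
  induction hf using Submodule.span_induction with
  | zero => rw [map_zero]; exact zero_mem _
  | add a b _ _ ha hb => rw [map_add]; exact add_mem ha hb
  | smul c a _ ha => rw [map_smul]; exact Submodule.smul_mem _ _ ha
  | mem a ha =>
    obtain ⟨u, hu, rfl⟩ := ha
    rw [polyP, linExt_mono]
    exact mono_mem (good_brP (mem_drbw_iff.1 hu)) (fun _ => hs) (fun _ => he)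

theorem diamond_mem_aux (lam : k) (u v : OpWord X) (hu : Good u) (hv : Good v) :
    diamond lam u v ∈ goodSpan k X (StartsP u) (EndsP v) := by
  by_cases h : EndsP u ∧ StartsP v
  · match u, v, hu, hv, h with
    | varMul x w, v, hu, hv, h =>
      rw [diamond]
      exact mul_mem_goodSpan (e := False) (mono_mem (w := var x) trivial id id)
        (diamond_mem_aux lam w v hu hv) fun h _ => h
    | brMul OpSym.D a w, v, hu, hv, h =>
      rw [diamond]
      exact mul_mem_goodSpan (e := False) (mono_mem (w := br OpSym.D a) hu.1 id id)
        (diamond_mem_aux lam w v hu.2 hv) fun h _ => h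
    | brMul OpSym.P a w, v, hu, hv, h =>
      rw [diamond]
      exact mul_mem_goodSpan (e := True)
        (mono_mem (w := br OpSym.P a) hu.1 (fun _ => trivial) (fun _ => trivial))
        (diamond_mem_aux lam w v hu.2.1 hv) fun _ h => hu.2.2 h
    | br OpSym.P a, br OpSym.P b, hu, hv, h =>
      rw [diamond]
      refine add_mem (add_mem ?_ ?_) (Submodule.smul_mem _ _ ?_) <;>
      refine polyP_mem (goodSpan_le _ _ (diamond_mem_aux lam _ _ ?_ ?_)) _ _ trivial trivial <;>
      assumption
    | br OpSym.P a, brMul OpSym.P b w, hu, hv, h =>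
      rw [diamond]
      refine mul_mem_goodSpan (e := True) (s' := StartsP w) (add_mem (add_mem ?_ ?_)
        (Submodule.smul_mem _ _ ?_)) (mono_mem hv.2.1 id id) fun _ h => hv.2.2 h
      · exact polyP_mem (goodSpan_le _ _ (diamond_mem_aux lam a (br OpSym.P b) hu hv.1))
          _ _ trivial trivial
      · exact polyP_mem (goodSpan_le _ _ (diamond_mem_aux lam (br OpSym.P a) b hu hv.1))
          _ _ trivial trivial
      · exact polyP_mem (goodSpan_le _ _ (diamond_mem_aux lam a b hu hv.1)) _ _ trivial trivial
  · rw [diamond_concat lam u v h]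
    exact mono_mem (good_mul hu hv fun h1 h2 => h ⟨h1, h2⟩) (fun h1 => (startsP_mul u v).1 h1)
      (fun h1 => (endsP_mul u v).1 h1)
termination_by sizeOf u + sizeOf v

theorem dWord_mem_aux (lam : k) (u : OpWord X) (hu : Good u) :
    dWord lam u ∈ goodSpan k X (StartsP u) (EndsP u) := by
  have key : ∀ (a w : OpWord X), Good a → Good w → (EndsP a → ¬ StartsP w) →
      dWord lam a ∈ goodSpan k X (StartsP a) (EndsP a) →
      dWord lam w ∈ goodSpan k X (StartsP w) (EndsP w) →
      dWord lam (a * w) ∈ goodSpan k X (StartsP (a * w)) (EndsP (a * w)) := by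
    intro a w ha hw h h1 h2
    rw [dWord_mul, startsP_mul, endsP_mul]
    exact add_mem (add_mem (mul_mem_goodSpan h1 (mono_mem hw id id) h)
      (mul_mem_goodSpan (mono_mem ha id id) h2 h))
      (Submodule.smul_mem _ _ (mul_mem_goodSpan h1 h2 h))
  induction u with
  | var x =>
    rw [dWord]
    exact mono_mem (var_mem_delta x) id id
  | br o a ih =>
    cases o
    · rw [dWord]
      exact mono_mem (brD_mem_delta hu) id id
    · rw [dWord]
      exact polyP_mem (goodSpan_le _ _ (ih hu)) _ _ trivial trivial
  | varMul x w ih =>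
    rw [← var_mul]
    refine key _ _ trivial hu (fun h => absurd h id) ?_ (ih hu)
    rw [dWord]
    exact mono_mem (var_mem_delta x) id id
  | brMul o a w iha ih =>
    rw [← br_mul]
    cases o
    · refine key _ _ hu.1 hu.2 (fun h => absurd h id) ?_ (ih hu.2)
      rw [dWord]
      exact mono_mem (brD_mem_delta hu.1) id id
    · refine key _ _ (good_brP hu.1) hu.2.1 (fun _ => hu.2.2) ?_ (ih hu.2.1)
      rw [dWord]
      exact polyP_mem (goodSpan_le _ _ (iha hu.1)) _ _ trivial trivial

theorem polyDiamond_mem (lam : k) {f g : MonoidAlgebra k (OpWord X)} (hf : f ∈ drbwSpan k X)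
    (hg : g ∈ drbwSpan k X) : polyDiamond lam f g ∈ drbwSpan k X := by
  induction hf using Submodule.span_induction with
  | zero => rw [map_zero]; exact zero_mem _
  | add a b _ _ ha hb => rw [map_add]; exact add_mem ha hb
  | smul c a _ ha => rw [map_smul]; exact Submodule.smul_mem _ _ ha
  | mem a ha =>
    obtain ⟨u, hu, rfl⟩ := ha
    induction hg using Submodule.span_induction with
    | zero => rw [map_zero]; exact zero_mem _
    | add a b _ _ ha hb => rw [map_add]; exact add_mem ha hb
    | smul c a _ ha => rw [map_smul]; exact Submodule.smul_mem _ _ ha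
    | mem b hb =>
      obtain ⟨v, hv, rfl⟩ := hb
      rw [polyDiamond, linExt_mono, linExt_mono]
      exact goodSpan_le _ _ (diamond_mem_aux lam u v (mem_drbw_iff.1 hu) (mem_drbw_iff.1 hv))

theorem polyD_mem (lam : k) {f : MonoidAlgebra k (OpWord X)} (hf : f ∈ drbwSpan k X) :
    polyD lam f ∈ drbwSpan k X := by
  induction hf using Submodule.span_induction with
  | zero => rw [map_zero]; exact zero_mem _
  | add a b _ _ ha hb => rw [map_add]; exact add_mem ha hb
  | smul c a _ ha => rw [map_smul]; exact Submodule.smul_mem _ _ ha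
  | mem a ha =>
    obtain ⟨u, hu, rfl⟩ := ha
    rw [polyD, linExt_mono]
    exact goodSpan_le _ _ (dWord_mem_aux lam u (mem_drbw_iff.1 hu))

end Polynomials

end OpWord

/-! ### The explicit algebra on `k𝔛_∞` -/

section Free

open OpWord

/-- The module `k𝔛_∞`, which carries the product `⋄` of weight `lam`. -/
def Sha (k : Type u) [CommRing k] (_lam : k) (X : Type v) : Type (max u v) :=
  drbwSpan k X

namespace Sha

variable {k : Type u} [CommRing k] {lam : k} {X : Type v}

noncomputable instance : AddCommGroup (Sha k lam X) :=
  inferInstanceAs (AddCommGroup (drbwSpan k X))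

noncomputable instance : Module k (Sha k lam X) :=
  inferInstanceAs (Module k (drbwSpan k X))

/-- The inclusion of `k𝔛_∞` into the bracketed polynomials. -/
noncomputable def incl : Sha k lam X →ₗ[k] MonoidAlgebra k (OpWord X) :=
  (drbwSpan k X).subtype

theorem incl_injective : Function.Injective (incl : Sha k lam X → MonoidAlgebra k (OpWord X)) :=
  Subtype.val_injective

/-- The product `⋄` on `k𝔛_∞`. -/
noncomputable instance : Mul (Sha k lam X) where
  mul a b := ⟨polyDiamond lam a.1 b.1, polyDiamond_mem lam a.2 b.2⟩

theorem incl_mul (a b : Sha k lam X) : incl (a * b) = polyDiamond lam (incl a) (incl b) := rfl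

noncomputable instance : NonUnitalNonAssocRing (Sha k lam X) :=
  { (inferInstance : AddCommGroup (Sha k lam X)), (inferInstance : Mul (Sha k lam X)) with
    left_distrib := fun a b c => incl_injective (by simp [incl_mul])
    right_distrib := fun a b c => incl_injective (by simp [incl_mul])
    zero_mul := fun a => incl_injective (by simp [incl_mul])
    mul_zero := fun a => incl_injective (by simp [incl_mul]) }

instance : IsScalarTower k (Sha k lam X) (Sha k lam X) where
  smul_assoc c a b := incl_injective (by simp [incl_mul])

instance : SMulCommClass k (Sha k lam X) (Sha k lam X) where
  smul_comm c a b := incl_injective (by simp [incl_mul])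

/-- The operator `d_X` on `k𝔛_∞`. -/
noncomputable def d (k : Type u) [CommRing k] (lam : k) (X : Type v) :
    Sha k lam X →ₗ[k] Sha k lam X :=
  (polyD lam).restrict fun _ h => polyD_mem lam h

/-- The operator `P_X` on `k𝔛_∞`, extending `u ↦ P(u)`. -/
noncomputable def P (k : Type u) [CommRing k] (lam : k) (X : Type v) :
    Sha k lam X →ₗ[k] Sha k lam X :=
  polyP.restrict fun _ h => goodSpan_le True True (polyP_mem h True True trivial trivial)

/-- The inclusion `j_X : X → k𝔛_∞`. -/
noncomputable def j (k : Type u) [CommRing k] (lam : k) (X : Type v) (x : X) : Sha k lam X :=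
  ⟨mono k (var x), Submodule.subset_span ⟨var x, mem_drbw_iff.2 trivial, rfl⟩⟩

end Sha

end Free

/-! The recursions for `⋄` and `d` make sense on all bracketed words, and the required identities
already hold there. They are therefore proved on `k𝔖(X)` and only then restricted to `k𝔛_∞`, which
is closed under the operations.

The main tool is locality: `⋄` changes only the junction between the last letter of the left factor
and the first letter of the right one, so `(e f) ⋄ g = e (f ⋄ g)` and `f ⋄ (g e) = (f ⋄ g) e`
(`polyDiamond_mul_left`, `polyDiamond_mul_right`). Together with the Leibniz rule for concatenation
(`polyD_mul`), this reduces associativity and the Leibniz rule for `⋄` to single letters. At a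
junction not formed by two `P`-letters, `⋄` is concatenation. When all letters are `P`-letters, the
Rota-Baxter recursion turns the claim into instances of smaller total size
(`polyDiamond_assoc_P_P_P`, `leibniz_P_P`).

For the universal property, words are evaluated in `A`. The identities of `A` are exactly what makes
evaluation respect `⋄`, `d` and `P` (`polyEval_polyDiamond`, `polyEval_D`, `polyEval_P`), which
gives existence. Uniqueness holds because every word of `𝔛_∞` is built from `X` by `⋄`, `d_X` and
`P_X` (`map_word`). -/

namespace OpWord

section Polynomials

variable {k : Type u} [CommRing k] {X : Type v}

/-- Bracketed polynomials are spanned by the bracketed words. -/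
theorem mono_induction {p : MonoidAlgebra k (OpWord X) → Prop} (f : MonoidAlgebra k (OpWord X))
    (zero : p 0) (add : ∀ f g, p f → p g → p (f + g)) (smul : ∀ (c : k) f, p f → p (c • f))
    (mono : ∀ w, p (mono k w)) : p f := by
  induction f using MonoidAlgebra.induction_linear with
  | zero => exact zero
  | add f g hf hg => exact add f g hf hg
  | single w c =>
    have e : (MonoidAlgebra.single w c : MonoidAlgebra k (OpWord X)) = c • OpWord.mono k w := by
      simp [OpWord.mono, MonoidAlgebra.smul_single]
    rw [e]
    exact smul c _ (mono w)

/-! ### Identities for bracketed polynomials -/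

@[simp] theorem polyP_mono (w : OpWord X) : polyP (mono k w) = mono k (br OpSym.P w) :=
  linExt_mono _ _

@[simp] theorem polyD_mono (lam : k) (w : OpWord X) : polyD lam (mono k w) = dWord lam w :=
  linExt_mono _ _

theorem polyDiamond_mono (lam : k) (u v : OpWord X) :
    polyDiamond lam (mono k u) (mono k v) = diamond lam u v := by
  simp [polyDiamond]

/-- Locality on the left: since words are nonempty, the last letter of a word of `f * g` comes from
`g`, so `f` never meets `h`. -/
theorem polyDiamond_mul_left (lam : k) (f g h : MonoidAlgebra k (OpWord X)) :
    polyDiamond lam (f * g) h = f * polyDiamond lam g h := by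
  induction f using mono_induction with
  | zero => simp
  | add a b ha hb => simp [add_mul, ha, hb]
  | smul c a ha => simp [smul_mul_assoc, ha]
  | mono u =>
    induction g using mono_induction with
    | zero => simp
    | add a b ha hb => simp [mul_add, ha, hb]
    | smul c a ha => simp [mul_smul_comm, ha]
    | mono v =>
      induction h using mono_induction with
      | zero => simp
      | add a b ha hb => simp [mul_add, ha, hb]
      | smul c a ha => simp [mul_smul_comm, ha]
      | mono w => simp [mono_mul, polyDiamond_mono, diamond_mul_left]

theorem polyDiamond_mul_right (lam : k) (f g h : MonoidAlgebra k (OpWord X)) :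
    polyDiamond lam f (g * h) = polyDiamond lam f g * h := by
  induction f using mono_induction with
  | zero => simp
  | add a b ha hb => simp [add_mul, ha, hb]
  | smul c a ha => simp [smul_mul_assoc, ha]
  | mono u =>
    induction g using mono_induction with
    | zero => simp
    | add a b ha hb => simp [add_mul, ha, hb]
    | smul c a ha => simp [smul_mul_assoc, ha]
    | mono v =>
      induction h using mono_induction with
      | zero => simp
      | add a b ha hb => simp [mul_add, ha, hb]
      | smul c a ha => simp [mul_smul_comm, ha]
      | mono w => simp [mono_mul, polyDiamond_mono, diamond_mul_right]

theorem polyDiamond_P_P (lam : k) (f g : MonoidAlgebra k (OpWord X)) :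
    polyDiamond lam (polyP f) (polyP g) =
      polyP (polyDiamond lam f (polyP g)) + polyP (polyDiamond lam (polyP f) g) +
        lam • polyP (polyDiamond lam f g) := by
  induction f using mono_induction with
  | zero => simp
  | add a b ha hb => simp only [map_add, LinearMap.add_apply, ha, hb, smul_add]; abel
  | smul c a ha => simp only [map_smul, LinearMap.smul_apply, ha, smul_add, smul_comm lam c]
  | mono u =>
    induction g using mono_induction with
    | zero => simp
    | add a b ha hb => simp only [map_add, ha, hb, smul_add]; abel
    | smul c a ha => simp only [map_smul, ha, smul_add, smul_comm lam c]
    | mono v => simp [polyDiamond_mono, diamond_P_P]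

/-- Without a `P`-letter at the end of `u` no two `P`-letters can meet. This disposes of all
junctions but `P` against `P`. -/
theorem polyDiamond_of_not_endsP (lam : k) {u : OpWord X} (hu : ¬ EndsP u)
    (f : MonoidAlgebra k (OpWord X)) : polyDiamond lam (mono k u) f = mono k u * f := by
  induction f using mono_induction with
  | zero => simp
  | add a b ha hb => simp [mul_add, ha, hb]
  | smul c a ha => simp [mul_smul_comm, ha]
  | mono v => rw [polyDiamond_mono, diamond_concat lam u v fun h => hu h.1, mono_mul]

theorem polyDiamond_of_not_startsP (lam : k) {v : OpWord X} (hv : ¬ StartsP v)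
    (f : MonoidAlgebra k (OpWord X)) : polyDiamond lam f (mono k v) = f * mono k v := by
  induction f using mono_induction with
  | zero => simp
  | add a b ha hb => simp [add_mul, ha, hb]
  | smul c a ha => simp [smul_mul_assoc, ha]
  | mono u => rw [polyDiamond_mono, diamond_concat lam u v fun h => hv h.2, mono_mul]

theorem polyD_mul (lam : k) (f g : MonoidAlgebra k (OpWord X)) :
    polyD lam (f * g) = polyD lam f * g + f * polyD lam g + lam • (polyD lam f * polyD lam g) := by
  induction f using mono_induction with
  | zero => simp
  | add a b ha hb => simp only [add_mul, map_add, ha, hb, smul_add]; abel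
  | smul c a ha =>
    simp only [smul_mul_assoc, map_smul, ha, smul_add, smul_comm lam c]
  | mono u =>
    induction g using mono_induction with
    | zero => simp
    | add a b ha hb => simp only [mul_add, map_add, ha, hb, smul_add]; abel
    | smul c a ha =>
      simp only [mul_smul_comm, map_smul, ha, smul_add, smul_comm lam c]
    | mono v => simp [mono_mul, dWord_mul]

theorem polyD_P (lam : k) (f : MonoidAlgebra k (OpWord X)) :
    polyD lam (polyP f) = polyP (polyD lam f) := by
  induction f using mono_induction with
  | zero => simp
  | add a b ha hb => simp [ha, hb]
  | smul c a ha => simp [ha]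
  | mono u => simp [dWord]

/-! ### Associativity of `⋄` -/

theorem sizeOf_pos (w : OpWord X) : 0 < sizeOf w := by
  cases w <;> simp

/-- The inductive step for the associativity of `⋄` on `P(f), P(g), P(h)`. -/
theorem polyDiamond_assoc_P_P_P (lam : k) {f g h : MonoidAlgebra k (OpWord X)}
    (h1 : polyDiamond lam (polyDiamond lam f (polyP g)) (polyP h) =
      polyDiamond lam f (polyDiamond lam (polyP g) (polyP h)))
    (h2 : polyDiamond lam (polyDiamond lam (polyP f) g) (polyP h) =
      polyDiamond lam (polyP f) (polyDiamond lam g (polyP h)))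
    (h3 : polyDiamond lam (polyDiamond lam (polyP f) (polyP g)) h =
      polyDiamond lam (polyP f) (polyDiamond lam (polyP g) h))
    (h4 : polyDiamond lam (polyDiamond lam f g) (polyP h) =
      polyDiamond lam f (polyDiamond lam g (polyP h)))
    (h5 : polyDiamond lam (polyDiamond lam f (polyP g)) h =
      polyDiamond lam f (polyDiamond lam (polyP g) h))
    (h6 : polyDiamond lam (polyDiamond lam (polyP f) g) h =
      polyDiamond lam (polyP f) (polyDiamond lam g h))
    (h7 : polyDiamond lam (polyDiamond lam f g) h =
      polyDiamond lam f (polyDiamond lam g h)) :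
    polyDiamond lam (polyDiamond lam (polyP f) (polyP g)) (polyP h) =
      polyDiamond lam (polyP f) (polyDiamond lam (polyP g) (polyP h)) := by
  have key (a b : MonoidAlgebra k (OpWord X)) : polyDiamond lam (polyP a) (polyP b) =
      polyP (polyDiamond lam a (polyP b) + polyDiamond lam (polyP a) b +
        lam • polyDiamond lam a b) := by
    rw [polyDiamond_P_P, map_add, map_add, map_smul]
  -- Each inner product must appear as a single `P(…)` for the outer one to be expanded. Afterwards
  -- `P(…)` is folded back into `P(f) ⋄ P(g)` or `P(g) ⋄ P(h)`, the form in which these products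
  -- occur in `h3` and `h1`.
  rw [key f g, key g h, key, key, ← key f g, ← key g h, h3]
  simp only [map_add, map_smul, LinearMap.add_apply, LinearMap.smul_apply, h1, h2, h4, h5, h6, h7,
    smul_add]
  abel

/-- Induction on total size. If `u` does not end, or `w` does not start, with a `P`-letter, one
product is a concatenation and locality suffices. Otherwise the outer letters of `u` and `w` are
stripped off. The only remaining interaction is among three single `P`-letters, where erasing `P`
from any nonempty subset of them gives the seven smaller instances needed. -/
theorem diamond_assoc (lam : k) (u v w : OpWord X) :
    polyDiamond lam (diamond lam u v) (mono k w) =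
      polyDiamond lam (mono k u) (diamond lam v w) := by
  by_cases hw : StartsP w
  swap
  · rw [polyDiamond_of_not_startsP lam hw, ← polyDiamond_mono lam v w,
      polyDiamond_of_not_startsP lam hw, polyDiamond_mul_right, polyDiamond_mono]
  by_cases hu : EndsP u
  swap
  · rw [polyDiamond_of_not_endsP lam hu, ← polyDiamond_mono lam u v,
      polyDiamond_of_not_endsP lam hu, polyDiamond_mul_left, polyDiamond_mono]
  match u, v, w, hu, hw with
  | varMul x u, v, w, hu, hw =>
    rw [← var_mul, diamond_mul_left, ← mono_mul, polyDiamond_mul_left, polyDiamond_mul_left,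
      diamond_assoc lam u v w]
  | brMul o a u, v, w, hu, hw =>
    rw [← br_mul, diamond_mul_left, ← mono_mul, polyDiamond_mul_left, polyDiamond_mul_left,
      diamond_assoc lam u v w]
  -- A middle word of at least two letters is touched by the two products at different ends, so they
  -- do not interfere and no recursion is needed.
  | br OpSym.P a, varMul x v, w, hu, hw =>
    rw [← var_mul, diamond_mul_right, diamond_mul_left, polyDiamond_mul_left,
      polyDiamond_mul_right, polyDiamond_mono, polyDiamond_mono]
  | br OpSym.P a, brMul o b v, w, hu, hw =>
    rw [← br_mul, diamond_mul_right, diamond_mul_left, polyDiamond_mul_left,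
      polyDiamond_mul_right, polyDiamond_mono, polyDiamond_mono]
  | br OpSym.P a, var x, w, hu, hw =>
    rw [diamond_concat lam _ (var x) fun h => h.2, diamond_concat lam (var x) w fun h => h.1,
      ← mono_mul, ← mono_mul, polyDiamond_mul_left, polyDiamond_mul_right,
      polyDiamond_of_not_startsP lam (v := var x) id, polyDiamond_of_not_endsP lam (u := var x) id,
      mul_assoc]
  | br OpSym.P a, br OpSym.D b, w, hu, hw =>
    rw [diamond_concat lam _ (br OpSym.D b) fun h => h.2,
      diamond_concat lam (br OpSym.D b) w fun h => h.1,
      ← mono_mul, ← mono_mul, polyDiamond_mul_left, polyDiamond_mul_right,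
      polyDiamond_of_not_startsP lam (v := br OpSym.D b) id,
      polyDiamond_of_not_endsP lam (u := br OpSym.D b) id, mul_assoc]
  | br OpSym.P a, br OpSym.P b, brMul OpSym.P c w, hu, hw =>
    rw [← br_mul, diamond_mul_right, ← mono_mul, polyDiamond_mul_right, polyDiamond_mul_right,
      diamond_assoc lam (br OpSym.P a) (br OpSym.P b) (br OpSym.P c)]
  | br OpSym.P a, br OpSym.P b, br OpSym.P c, hu, hw =>
    have h1 := diamond_assoc lam a (br OpSym.P b) (br OpSym.P c)
    have h2 := diamond_assoc lam (br OpSym.P a) b (br OpSym.P c)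
    have h3 := diamond_assoc lam (br OpSym.P a) (br OpSym.P b) c
    have h4 := diamond_assoc lam a b (br OpSym.P c)
    have h5 := diamond_assoc lam a (br OpSym.P b) c
    have h6 := diamond_assoc lam (br OpSym.P a) b c
    have h7 := diamond_assoc lam a b c
    simp only [← polyDiamond_mono, ← polyP_mono] at h1 h2 h3 h4 h5 h6 h7 ⊢
    exact polyDiamond_assoc_P_P_P lam h1 h2 h3 h4 h5 h6 h7
termination_by sizeOf u + sizeOf v + sizeOf w
decreasing_by
  all_goals
    have := sizeOf_pos w
    simp only [br.sizeOf_spec, varMul.sizeOf_spec, brMul.sizeOf_spec]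
    omega

theorem polyDiamond_assoc (lam : k) (f g h : MonoidAlgebra k (OpWord X)) :
    polyDiamond lam (polyDiamond lam f g) h = polyDiamond lam f (polyDiamond lam g h) := by
  induction f using mono_induction with
  | zero => simp
  | add a b ha hb => simp [ha, hb]
  | smul c a ha => simp [ha]
  | mono u =>
    induction g using mono_induction with
    | zero => simp
    | add a b ha hb => simp [ha, hb]
    | smul c a ha => simp [ha]
    | mono v =>
      induction h using mono_induction with
      | zero => simp
      | add a b ha hb => simp [ha, hb]
      | smul c a ha => simp [ha]
      | mono w => simp [polyDiamond_mono, diamond_assoc]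

/-! ### The Leibniz rule for `⋄` -/

/-- The Leibniz rule of weight `lam` holds for `d(f ⋄ g)`. -/
def Leibniz (lam : k) (f g : MonoidAlgebra k (OpWord X)) : Prop :=
  polyD lam (polyDiamond lam f g) =
    polyDiamond lam (polyD lam f) g + polyDiamond lam f (polyD lam g) +
      lam • polyDiamond lam (polyD lam f) (polyD lam g)

/-- Locality moves `e` out of every `⋄`, and the Leibniz rule for concatenation separates `d(e)`.
Letters away from the junction can thus be stripped. -/
theorem Leibniz.mul_left {lam : k} {f g : MonoidAlgebra k (OpWord X)} (h : Leibniz lam f g)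
    (e : MonoidAlgebra k (OpWord X)) : Leibniz lam (e * f) g := by
  unfold Leibniz at h ⊢
  simp only [polyDiamond_mul_left, polyD_mul, h, map_add, map_smul, LinearMap.add_apply,
    LinearMap.smul_apply, mul_add, mul_smul_comm, smul_add]
  abel

theorem Leibniz.mul_right {lam : k} {f g : MonoidAlgebra k (OpWord X)} (h : Leibniz lam f g)
    (e : MonoidAlgebra k (OpWord X)) : Leibniz lam f (g * e) := by
  unfold Leibniz at h ⊢
  simp only [polyDiamond_mul_right, polyD_mul, h, map_add, map_smul, add_mul, smul_mul_assoc,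
    smul_add]
  abel

/-- Meant for a letter `x` or `D(…)`, whose image under `d` is again a `D`-letter: every `⋄` in the
rule is then a concatenation. -/
theorem leibniz_of_not_endsP {lam : k} {a a' : OpWord X} (ha : ¬ EndsP a) (ha' : ¬ EndsP a')
    (hd : dWord lam a = mono k a') (g : MonoidAlgebra k (OpWord X)) :
    Leibniz lam (mono k a) g := by
  unfold Leibniz
  simp only [polyD_mono, hd, polyDiamond_of_not_endsP lam ha, polyDiamond_of_not_endsP lam ha',
    polyD_mul]

theorem leibniz_of_not_startsP {lam : k} {a a' : OpWord X} (ha : ¬ StartsP a)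
    (ha' : ¬ StartsP a') (hd : dWord lam a = mono k a') (f : MonoidAlgebra k (OpWord X)) :
    Leibniz lam f (mono k a) := by
  unfold Leibniz
  simp only [polyD_mono, hd, polyDiamond_of_not_startsP lam ha, polyDiamond_of_not_startsP lam ha',
    polyD_mul]

/-- Here `d P = P d` is essential: `d(P(f))` is again of the form `P(…)`, so the Rota-Baxter rule
also expands the differentiated products, and the terms match those of the three hypotheses. -/
theorem leibniz_P_P {lam : k} {f g : MonoidAlgebra k (OpWord X)} (h1 : Leibniz lam f (polyP g))
    (h2 : Leibniz lam (polyP f) g) (h3 : Leibniz lam f g) :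
    Leibniz lam (polyP f) (polyP g) := by
  unfold Leibniz at h1 h2 h3 ⊢
  simp only [polyD_P] at h1 h2 ⊢
  simp only [polyDiamond_P_P, map_add, map_smul, polyD_P, h1, h2, h3, smul_add]
  abel

theorem leibniz_mono (lam : k) (u v : OpWord X) : Leibniz lam (mono k u) (mono k v) := by
  match u, v with
  | varMul x u, v =>
    rw [← var_mul, ← mono_mul]
    exact (leibniz_mono lam u v).mul_left _
  | brMul o a u, v =>
    rw [← br_mul, ← mono_mul]
    exact (leibniz_mono lam u v).mul_left _
  | var x, v => exact leibniz_of_not_endsP (a' := br OpSym.D (var x)) id id (by rw [dWord]) _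
  | br OpSym.D a, v =>
    exact leibniz_of_not_endsP (a' := br OpSym.D (br OpSym.D a)) id id (by rw [dWord]) _
  -- Only the first letter of the right factor matters; the size drops because the removed tail `v`
  -- has positive size.
  | br OpSym.P a, varMul x v =>
    rw [← var_mul, ← mono_mul]
    exact (leibniz_mono lam (br OpSym.P a) (var x)).mul_right _
  | br OpSym.P a, brMul o b v =>
    rw [← br_mul, ← mono_mul]
    exact (leibniz_mono lam (br OpSym.P a) (br o b)).mul_right _
  | br OpSym.P a, var x =>
    exact leibniz_of_not_startsP (a' := br OpSym.D (var x)) id id (by rw [dWord]) _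
  | br OpSym.P a, br OpSym.D b =>
    exact leibniz_of_not_startsP (a' := br OpSym.D (br OpSym.D b)) id id (by rw [dWord]) _
  | br OpSym.P a, br OpSym.P b =>
    have h1 := leibniz_mono lam a (br OpSym.P b)
    have h2 := leibniz_mono lam (br OpSym.P a) b
    have h3 := leibniz_mono lam a b
    rw [← polyP_mono] at h1 h2
    rw [← polyP_mono, ← polyP_mono]
    exact leibniz_P_P h1 h2 h3
termination_by sizeOf u + sizeOf v
decreasing_by
  all_goals
    have := sizeOf_pos v
    simp only [br.sizeOf_spec, varMul.sizeOf_spec, brMul.sizeOf_spec, var.sizeOf_spec]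
    omega

theorem polyD_polyDiamond (lam : k) (f g : MonoidAlgebra k (OpWord X)) :
    polyD lam (polyDiamond lam f g) =
      polyDiamond lam (polyD lam f) g + polyDiamond lam f (polyD lam g) +
        lam • polyDiamond lam (polyD lam f) (polyD lam g) := by
  induction f using mono_induction with
  | zero => simp
  | add a b ha hb => simp only [map_add, LinearMap.add_apply, ha, hb, smul_add]; abel
  | smul c a ha => simp only [map_smul, LinearMap.smul_apply, ha, smul_add, smul_comm lam c]
  | mono u =>
    induction g using mono_induction with
    | zero => simp
    | add a b ha hb => simp only [map_add, ha, hb, smul_add]; abel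
    | smul c a ha => simp only [map_smul, ha, smul_add, smul_comm lam c]
    | mono v => exact leibniz_mono lam u v

/-! ### Evaluation of bracketed words -/

section Eval

variable {A : Type w} [NonUnitalNonAssocRing A] [Module k A]

/-- The value of a bracketed word in an algebra with operators `dA` and `PA`. -/
def eval (dA PA : A →ₗ[k] A) (f : X → A) : OpWord X → A
  | var x => f x
  | br OpSym.D u => dA (eval dA PA f u)
  | br OpSym.P u => PA (eval dA PA f u)
  | varMul x w => f x * eval dA PA f w
  | brMul OpSym.D u w => dA (eval dA PA f u) * eval dA PA f w
  | brMul OpSym.P u w => PA (eval dA PA f u) * eval dA PA f w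

/-- The linear extension of `eval` to bracketed polynomials. -/
noncomputable def polyEval (dA PA : A →ₗ[k] A) (f : X → A) : MonoidAlgebra k (OpWord X) →ₗ[k] A :=
  linExt (eval dA PA f)

@[simp] theorem polyEval_mono (dA PA : A →ₗ[k] A) (f : X → A) (w : OpWord X) :
    polyEval dA PA f (mono k w) = eval dA PA f w :=
  linExt_mono _ _

theorem polyEval_P (dA PA : A →ₗ[k] A) (f : X → A) (g : MonoidAlgebra k (OpWord X)) :
    polyEval dA PA f (polyP g) = PA (polyEval dA PA f g) := by
  induction g using mono_induction with
  | zero => simp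
  | add a b ha hb => simp [ha, hb]
  | smul c a ha => simp [ha]
  | mono u => simp [eval]

variable {lam : k} {dA PA : A →ₗ[k] A}

/-- Words are evaluated bracketed to the right, so this is where associativity of `A` enters. -/
theorem eval_mul (h : IsParaDiffRotaBaxter lam dA PA) (f : X → A) (u v : OpWord X) :
    eval dA PA f (u * v) = eval dA PA f u * eval dA PA f v := by
  induction u with
  | var x => rfl
  | br o a _ => cases o <;> rfl
  | varMul x w ih => simp only [varMul_mul, eval, ih, h.mul_assoc]
  | brMul o a w _ ih => cases o <;> simp only [brMul_mul, eval, ih, h.mul_assoc]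

variable [IsScalarTower k A A] [SMulCommClass k A A]

theorem polyEval_mul (h : IsParaDiffRotaBaxter lam dA PA) (f : X → A)
    (g g' : MonoidAlgebra k (OpWord X)) :
    polyEval dA PA f (g * g') = polyEval dA PA f g * polyEval dA PA f g' := by
  induction g using mono_induction with
  | zero => simp
  | add a b ha hb => simp [add_mul, ha, hb]
  | smul c a ha => simp [smul_mul_assoc, ha]
  | mono u =>
    induction g' using mono_induction with
    | zero => simp
    | add a b ha hb => simp only [map_add, mul_add, ha, hb]
    | smul c a ha => simp only [map_smul, mul_smul_comm, ha]
    | mono v => simp [mono_mul, eval_mul h]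

theorem polyEval_dWord (h : IsParaDiffRotaBaxter lam dA PA) (f : X → A) (u : OpWord X) :
    polyEval dA PA f (dWord lam u) = dA (eval dA PA f u) := by
  induction u with
  | var x => simp [dWord, eval]
  | br o a ih => cases o <;> simp [dWord, eval, polyEval_P, ih, h.d_P]
  | varMul x w ih => simp [dWord, eval, polyEval_mul h, ih, h.d_mul]
  | brMul o a w iha ih =>
    cases o <;> simp [dWord, eval, polyEval_mul h, polyEval_P, ih, iha, h.d_mul, h.d_P]

theorem polyEval_D (h : IsParaDiffRotaBaxter lam dA PA) (f : X → A)
    (g : MonoidAlgebra k (OpWord X)) :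
    polyEval dA PA f (polyD lam g) = dA (polyEval dA PA f g) := by
  induction g using mono_induction with
  | zero => simp
  | add a b ha hb => simp [ha, hb]
  | smul c a ha => simp [ha]
  | mono u => simp [polyEval_dWord h]

/-- The recursion for `⋄` at two `P`-letters is the Rota-Baxter identity read from left to right. As
that identity holds in `A`, evaluation does not distinguish `⋄` from concatenation. -/
theorem polyEval_diamond (h : IsParaDiffRotaBaxter lam dA PA) (f : X → A) (u v : OpWord X) :
    polyEval dA PA f (diamond lam u v) = eval dA PA f u * eval dA PA f v := by
  by_cases huv : EndsP u ∧ StartsP v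
  swap
  · rw [diamond_concat lam u v huv, polyEval_mono, eval_mul h]
  match u, v, huv with
  | varMul x u, v, huv =>
    rw [← var_mul, diamond_mul_left, polyEval_mul h, polyEval_diamond h f u v, polyEval_mono,
      eval_mul h, h.mul_assoc]
  | brMul o a u, v, huv =>
    rw [← br_mul, diamond_mul_left, polyEval_mul h, polyEval_diamond h f u v, polyEval_mono,
      eval_mul h, h.mul_assoc]
  | br OpSym.P a, brMul OpSym.P b v, huv =>
    rw [← br_mul, diamond_mul_right, polyEval_mul h,
      polyEval_diamond h f (br OpSym.P a) (br OpSym.P b), polyEval_mono, eval_mul h, h.mul_assoc]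
  | br OpSym.P a, br OpSym.P b, huv =>
    simp only [diamond_P_P, map_add, map_smul, polyEval_P,
      polyEval_diamond h f a (br OpSym.P b), polyEval_diamond h f (br OpSym.P a) b,
      polyEval_diamond h f a b, eval, h.P_mul_P]
termination_by sizeOf u + sizeOf v
decreasing_by
  all_goals
    have := sizeOf_pos v
    simp only [br.sizeOf_spec, varMul.sizeOf_spec, brMul.sizeOf_spec]
    omega

theorem polyEval_polyDiamond (h : IsParaDiffRotaBaxter lam dA PA) (f : X → A)
    (g g' : MonoidAlgebra k (OpWord X)) :
    polyEval dA PA f (polyDiamond lam g g') = polyEval dA PA f g * polyEval dA PA f g' := by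
  induction g using mono_induction with
  | zero => simp
  | add a b ha hb => simp [add_mul, ha, hb]
  | smul c a ha => simp [smul_mul_assoc, ha]
  | mono u =>
    induction g' using mono_induction with
    | zero => simp
    | add a b ha hb => simp only [map_add, mul_add, ha, hb]
    | smul c a ha => simp only [map_smul, mul_smul_comm, ha]
    | mono v => simp [polyDiamond_mono, polyEval_diamond h]

end Eval

end Polynomials

end OpWord

/-! ### The algebra structure on `k𝔛_∞` and its universal property -/

section Free

open OpWord

namespace Sha

variable {k : Type u} [CommRing k] {lam : k} {X : Type v}

/-- Each axiom is inherited from the same identity on all bracketed polynomials through the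
injective inclusion. -/
theorem isParaDiffRotaBaxter (lam : k) (X : Type v) :
    IsParaDiffRotaBaxter lam (d k lam X) (P k lam X) where
  mul_assoc a b c := incl_injective (polyDiamond_assoc lam a.1 b.1 c.1)
  d_mul a b := incl_injective (polyD_polyDiamond lam a.1 b.1)
  P_mul_P a b := incl_injective (polyDiamond_P_P lam a.1 b.1)
  d_P a := incl_injective (polyD_P lam a.1)

/-- A word in `𝔛_∞` as an element of `k𝔛_∞`. -/
noncomputable def word (lam : k) (w : OpWord X) (hw : Good w) : Sha k lam X :=
  ⟨mono k w, Submodule.subset_span ⟨w, mem_drbw_iff.2 hw, rfl⟩⟩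

theorem word_mul (u v : OpWord X) (hu : Good u) (hv : Good v) (huv : ¬ (EndsP u ∧ StartsP v))
    (h : Good (u * v)) : word lam (u * v) h = word lam u hu * word lam v hv :=
  incl_injective ((diamond_concat lam u v huv).symm.trans (polyDiamond_mono lam u v).symm)

theorem word_P {u : OpWord X} (hu : Good u) (h : Good (br OpSym.P u)) :
    word lam (br OpSym.P u) h = P k lam X (word lam u hu) :=
  incl_injective (polyP_mono u).symm

/-- Membership in `Δ(X)` is needed: on other words `d_X` does not simply add a bracket `D`. -/
theorem word_D {u : OpWord X} (hu : u ∈ Delta X) (hg : Good u) (h : Good (br OpSym.D u)) :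
    word lam (br OpSym.D u) h = d k lam X (word lam u hg) := by
  refine incl_injective (Eq.trans ?_ (polyD_mono lam u).symm)
  rcases delta_cases hu with ⟨x, rfl⟩ | ⟨a, _, rfl⟩ <;> rw [dWord] <;> rfl

/-- `k𝔛_∞` is spanned by the words in `𝔛_∞`. -/
theorem linearMap_ext {M : Type*} [AddCommGroup M] [Module k M] {φ ψ : Sha k lam X →ₗ[k] M}
    (h : ∀ w hw, φ (word lam w hw) = ψ (word lam w hw)) : φ = ψ := by
  ext ⟨a, ha⟩
  induction ha using Submodule.span_induction with
  | zero => exact (map_zero φ).trans (map_zero ψ).symm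
  | add a b ha hb iha ihb =>
    exact (map_add φ ⟨a, ha⟩ ⟨b, hb⟩).trans
      ((congrArg₂ _ iha ihb).trans (map_add ψ ⟨a, ha⟩ ⟨b, hb⟩).symm)
  | smul c a ha iha =>
    exact (map_smul φ c ⟨a, ha⟩).trans ((congrArg _ iha).trans (map_smul ψ c ⟨a, ha⟩).symm)
  | mem a ha =>
    obtain ⟨w, hw, rfl⟩ := ha
    exact h w (mem_drbw_iff.1 hw)

section Lift

variable {A : Type w} [NonUnitalNonAssocRing A] [Module k A] {dA PA : A →ₗ[k] A}

/-- The values on generators determine a morphism. This uses that the words are in `𝔛_∞`: a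
`D`-bracket encloses only an element of `Δ(X)`, hence comes from `d_X`, and `P`-letters are never
adjacent, so splitting off the first letter is a `⋄`-factorization. -/
theorem map_word {φ : Sha k lam X →ₙₐ[k] A} (f : X → A) (hd : ∀ a, φ (d k lam X a) = dA (φ a))
    (hP : ∀ a, φ (P k lam X a) = PA (φ a)) (hj : ∀ x, φ (j k lam X x) = f x) (w : OpWord X)
    (hw : Good w) : φ (word lam w hw) = eval dA PA f w := by
  have good_of_delta {u : OpWord X} (hu : u ∈ Delta X) : Good u :=
    (good_closure_delta (Subsemigroup.subset_closure hu)).1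
  have map_word_D (u : OpWord X) (hu : u ∈ Delta X) (hD : Good (br OpSym.D u))
      (ih : ∀ h, φ (word lam u h) = eval dA PA f u) :
      φ (word lam (br OpSym.D u) hD) = eval dA PA f (br OpSym.D u) := by
    rw [word_D hu (good_of_delta hu), hd, ih, eval]
  have map_word_P (u : OpWord X) (hu : Good u) (h : Good (br OpSym.P u))
      (ih : ∀ h, φ (word lam u h) = eval dA PA f u) :
      φ (word lam (br OpSym.P u) h) = eval dA PA f (br OpSym.P u) := by
    rw [word_P hu, hP, ih, eval]
  have map_word_mul (u v : OpWord X) (hu : Good u) (hv : Good v) (huv : ¬ (EndsP u ∧ StartsP v))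
      (h : Good (u * v)) : φ (word lam (u * v) h) = φ (word lam u hu) * φ (word lam v hv) := by
    rw [word_mul u v hu hv huv, map_mul]
  induction w with
  | var x => exact hj x
  | br o u ih =>
    cases o
    · exact map_word_D u hw hw ih
    · exact map_word_P u hw hw ih
  | varMul x w ih =>
    exact (map_word_mul (var x) w trivial hw (fun h => h.1) hw).trans
      (congrArg₂ _ (hj x) (ih hw))
  | brMul o u w ihu ihw =>
    cases o
    · exact (map_word_mul (br OpSym.D u) w hw.1 hw.2 (fun h => h.1) hw).trans
        (congrArg₂ _ (map_word_D u hw.1 hw.1 ihu) (ihw hw.2))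
    · exact (map_word_mul (br OpSym.P u) w hw.1 hw.2.1 (fun h => hw.2.2 h.2) hw).trans
        (congrArg₂ _ (map_word_P u hw.1 hw.1 ihu) (ihw hw.2.1))

variable [IsScalarTower k A A] [SMulCommClass k A A]

/-- The morphism `k𝔛_∞ → A` extending `f : X → A`. -/
noncomputable def lift (h : IsParaDiffRotaBaxter lam dA PA) (f : X → A) : Sha k lam X →ₙₐ[k] A :=
  { polyEval dA PA f ∘ₗ incl with
    map_zero' := map_zero (polyEval dA PA f ∘ₗ incl)
    map_mul' := fun a b => polyEval_polyDiamond h f (incl a) (incl b) }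

/-- The argument is uniform in `lam`, so it serves both types. -/
theorem existsUnique_lift (h : IsParaDiffRotaBaxter lam dA PA) (f : X → A) :
    ∃! φ : Sha k lam X →ₙₐ[k] A,
      (∀ a, φ (d k lam X a) = dA (φ a)) ∧ (∀ a, φ (P k lam X a) = PA (φ a)) ∧
        ∀ x, φ (j k lam X x) = f x := by
  refine ⟨lift h f, ⟨fun a => polyEval_D h f (incl a), fun a => polyEval_P dA PA f (incl a),
    fun x => polyEval_mono dA PA f (var x)⟩, fun φ hφ => ?_⟩
  have e : (φ : Sha k lam X →ₗ[k] A) = polyEval dA PA f ∘ₗ incl := linearMap_ext fun w hw =>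
    (map_word f hφ.1 hφ.2.1 hφ.2.2 w hw).trans (polyEval_mono dA PA f w).symm
  exact NonUnitalAlgHom.ext fun a => LinearMap.congr_fun e a

end Lift

end Sha

end Free

theorem mainTheorem1 (k : Type u) [CommRing k] (X : Type v) :
    IsFreeTypeI.{u, max u v, w, v} k (Sha.d k 0 X) (Sha.P k 0 X) (Sha.j k 0 X) ∧
    ∀ lam : k, lam ≠ 0 →
      IsFreeTypeII.{u, max u v, w, v} lam (Sha.d k lam X) (Sha.P k lam X) (Sha.j k lam X) :=
  ⟨⟨Sha.isParaDiffRotaBaxter 0 X, fun _ _ _ _ _ _ _ h f => Sha.existsUnique_lift h f⟩,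
    fun lam hlam => ⟨⟨hlam, Sha.isParaDiffRotaBaxter lam X⟩,
      fun _ _ _ _ _ _ _ h f => Sha.existsUnique_lift h.2 f⟩⟩
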